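/- All Hilbert spaces are complex and finite dimensional, alphabets are non-empty finite sets, $\mathbb C^{\mathcal X}$ has the computational basis $\{|x\rangle : x\in\mathcal X\}$, $\mathcal L(\mathsf H)$ denotes the linear operators on $\mathsf H$, a channel is a completely positive trace-preserving linear map, and $\|L\|_1=\operatorname{Tr}\sqrt{L^\dagger L}$. An element $x$ of an alphabet $\mathcal X$ is identified with the operator $|x\rangle\langle x|$ on $\mathbb C^{\mathcal X}$. An augmented quantum encryption of classical messages (AQECM) scheme is a triple $(K,E,D)$ of channels $$K:\mathcal L(\mathbb C)\to\mathcal L(\mathsf K),\qquad E:\mathcal L(\mathsf K\otimes\mathsf M)\to\mathcal L(\mathsf C),\qquad D:\mathcal L(\mathsf K\otimes\mathsf C)\to\mathcal L(\mathsf M\otimes\mathsf F),$$ where $\mathsf K=\mathbb C^{\mathcal K}$ and $\mathsf M=\mathbb C^{\mathcal M}$ for alphabets $\mathcal K$ (keys) and $\mathcal M$ (messages), $\mathsf F=\mathbb C^{\{0,1\}}$, and $\mathsf C$ is a Hilbert space. For $k\in\mathcal K$ put $E_k(\rho)=E(k\otimes\rho)$, $D_k(\rho)=D(k\otimes\rho)$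 and $\overline D_k(\rho)=(I_{\mathsf M}\otimes\langle 1|)\,D_k(\rho)\,(I_{\mathsf M}\otimes|1\rangle)$. Write $k\gets K$ for the random key with $\Pr[k]=\langle k|K(1)|k\rangle$. For $\epsilon,\delta\in\mathbb R$, the scheme is - $\epsilon$-correct if $\mathbb E_{k\gets K}\,\langle m|\,\overline D_k(E_k(m))\,|m\rangle\ge 1-\epsilon$ for all $m\in\mathcal M$; - $\delta$-tamper-evident if for all $m,m'\in\mathcal M$, all Hilbert spaces $\mathsf A$ and all channels $A:\mathcal L(\mathsf C)\to\mathcal L(\mathsf C\otimes\mathsf A)$, $$\Pr_{k\gets K}\Big[\tfrac12\big\|\big((\operatorname{Tr}_{\mathsf M}\circ\overline D_k)\otimes\mathrm{Id}_{\mathsf A}\big)\circ A\circ E_k(m-m')\big\|_1\le\delta\Big]\ge 1-\delta;$$ - $\delta$-encrypting if $\tfrac12\big\|\mathbb E_{k\gets K}E_k(m_0-m_1)\big\|_1\le\delta$ for all $m_0,m_1\in\mathcal M$. **Theorem.** Let $\epsilon,\delta\in\mathbb R$. Every $\epsilon$-correct, $\delta$-tamper-evident AQECM scheme is $\sqrt{19\,(\delta+\sqrt{2\epsilon})}$-encrypting.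 -/

import Mathlib

open scoped Kronecker MatrixOrder ComplexOrder

noncomputable section

namespace TamperEvidence

/-- Operators on the Hilbert space `ℂ^X` with computational basis `X`, as matrices in that basis.
Every finite-dimensional Hilbert space is of this form after a choice of orthonormal basis, and
`ℂ^X ⊗ ℂ^Y` is `ℂ^(X × Y)`. -/
abbrev Op (X : Type*) : Type _ := Matrix X X ℂ

/-- The Schatten 1-norm `Tr √(A† A)`. -/
def traceNorm {X : Type*} [Fintype X] [DecidableEq X] (A : Op X) : ℝ :=
  (Matrix.trace (CFC.sqrt (A.conjTranspose * A))).re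

/-- The map `Φ ⊗ Id_Z`: the linear map sending `L ⊗ N` to `Φ(L) ⊗ N`. -/
def tensorId {X Y : Type*} (Φ : Op X →ₗ[ℂ] Op Y) (Z : Type*) :
    Op (X × Z) →ₗ[ℂ] Op (Y × Z) where
  toFun M := Matrix.of fun p q => Φ (M.submatrix (fun x => (x, p.2)) (fun x => (x, q.2))) p.1 q.1
  map_add' M N := by
    ext p q
    simp [Matrix.submatrix_add]
  map_smul' c M := by
    ext p q
    simp [Matrix.submatrix_smul]

/-- The map `Tr_X ⊗ Id_Z`. -/
def traceFirst {X Z : Type*} [Fintype X] (M : Op (X × Z)) : Op Z :=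
  Matrix.of fun z z' => ∑ x, M (x, z) (x, z')

/-- A (quantum) channel: a completely positive, trace-preserving linear map. -/
structure IsChannel {X Y : Type*} [Fintype X] [Fintype Y] (Φ : Op X →ₗ[ℂ] Op Y) : Prop where
  completely_positive : ∀ (Z : Type) [Fintype Z] (M : Op (X × Z)),
    M.PosSemidef → (tensorId Φ Z M).PosSemidef
  trace_preserving : ∀ L : Op X, (Φ L).trace = L.trace

/-- The projector `|x⟩⟨x|` on a computational basis vector. -/
def basisState {X : Type*} [DecidableEq X] (x : X) : Op X := Matrix.single x x 1

/-- An augmented quantum encryption of classical messages scheme with key alphabet `𝒦`, message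
alphabet `ℳ` and ciphertext space `ℂ^𝒞`. The flag qubit is `ℂ^Bool`, with `true` for "accept". -/
structure AQECM (𝒦 ℳ 𝒞 : Type*) [Fintype 𝒦] [Fintype ℳ] [Fintype 𝒞] where
  keyGen : Op Unit →ₗ[ℂ] Op 𝒦
  enc : Op (𝒦 × ℳ) →ₗ[ℂ] Op 𝒞
  dec : Op (𝒦 × 𝒞) →ₗ[ℂ] Op (ℳ × Bool)
  keyGen_channel : IsChannel keyGen
  enc_channel : IsChannel enc
  dec_channel : IsChannel dec

namespace AQECM

variable {𝒦 ℳ 𝒞 : Type*} [Fintype 𝒦] [Fintype ℳ] [Fintype 𝒞]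

/-- The probability of `k` when the state output by key generation on the empty input is measured
in the computational basis. -/
def keyProb (S : AQECM 𝒦 ℳ 𝒞) (k : 𝒦) : ℝ := (S.keyGen 1 k k).re

/-- The probability over a generated key that the key satisfies `P`. -/
def probKey (S : AQECM 𝒦 ℳ 𝒞) (P : 𝒦 → Prop) : ℝ :=
  ∑ k, Set.indicator {k | P k} S.keyProb k

/-- The encoding map `E_k : ρ ↦ E(|k⟩⟨k| ⊗ ρ)`. -/
def encKey [DecidableEq 𝒦] (S : AQECM 𝒦 ℳ 𝒞) (k : 𝒦) : Op ℳ →ₗ[ℂ] Op 𝒞 :=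
  S.enc ∘ₗ Matrix.kroneckerBilinear (R := ℂ) (basisState k)

/-- The decoding map `D_k : ρ ↦ D(|k⟩⟨k| ⊗ ρ)`. -/
def decKey [DecidableEq 𝒦] (S : AQECM 𝒦 ℳ 𝒞) (k : 𝒦) : Op 𝒞 →ₗ[ℂ] Op (ℳ × Bool) :=
  S.dec ∘ₗ Matrix.kroneckerBilinear (R := ℂ) (basisState k)

/-- The map `ρ ↦ (I ⊗ ⟨1|) D_k(ρ) (I ⊗ |1⟩)`: decode with key `k` and reduce to acceptance. -/
def decAccept [DecidableEq 𝒦] (S : AQECM 𝒦 ℳ 𝒞) (k : 𝒦) : Op 𝒞 →ₗ[ℂ] Op ℳ where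
  toFun ρ := (S.decKey k ρ).submatrix (fun m => (m, true)) (fun m => (m, true))
  map_add' ρ σ := by simp [Matrix.submatrix_add]
  map_smul' c ρ := by simp [Matrix.submatrix_smul]

variable [DecidableEq 𝒦] [DecidableEq ℳ]

/-- `ε`-correctness: on average over the keys, every message is accepted and correctly recovered
with probability at least `1 - ε`. -/
def IsCorrect (S : AQECM 𝒦 ℳ 𝒞) (ε : ℝ) : Prop :=
  ∀ m : ℳ, 1 - ε ≤
    ∑ k, S.keyProb k * (S.decAccept k (S.encKey k (basisState m)) m m).re

/-- The operator `((Tr_ℳ ∘ D̄_k) ⊗ Id_A) ∘ A ∘ E_k (L)` on the adversary's register. -/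
def attackOutput (S : AQECM 𝒦 ℳ 𝒞) {A : Type*}
    (attack : Op 𝒞 →ₗ[ℂ] Op (𝒞 × A)) (k : 𝒦) (L : Op ℳ) : Op A :=
  traceFirst (tensorId (S.decAccept k) A (attack (S.encKey k L)))

/-- `δ`-tamper evidence: for every tamper attack, i.e. every channel from the ciphertext space to
the ciphertext space tensored with an adversary's register. -/
def IsTamperEvident (S : AQECM 𝒦 ℳ 𝒞) (δ : ℝ) : Prop :=
  ∀ (m m' : ℳ) (A : Type) [Fintype A] [DecidableEq A] (attack : Op 𝒞 →ₗ[ℂ] Op (𝒞 × A)),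
    IsChannel attack →
    1 - δ ≤ S.probKey fun k =>
      1 / 2 * traceNorm (S.attackOutput attack k (basisState m - basisState m')) ≤ δ

/-- `δ`-encryption: averaged over the keys, the encodings of any two messages are within `δ` in
trace distance. -/
def IsEncrypting [DecidableEq 𝒞] (S : AQECM 𝒦 ℳ 𝒞) (δ : ℝ) : Prop :=
  ∀ m₀ m₁ : ℳ,
    1 / 2 * traceNorm
      (∑ k, (S.keyProb k : ℂ) • S.encKey k (basisState m₀ - basisState m₁)) ≤ δ

end AQECM

end TamperEvidence

end

noncomputable section

namespace TamperEvidence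

/-! ### Trace norm -/

section TraceNorm

variable {X : Type*} [Fintype X] [DecidableEq X]

/-! Information gained about the message must leave a trace. The key-averaged difference of two
ciphertexts is Hermitian and traceless, so half its trace norm is `Tr (P L)` for a projection `P`
that does not depend on the key. The attack measures `{P, 1 - P}` coherently and keeps the outcome
qubit. Coherence matters: the off-diagonal entries of that qubit, with one diagonal entry, recover
the acceptance functional on `PΔ + ΔP`, where `Δ` is the difference for one key
(`acceptProb_anticommutator`). Tamper evidence makes this small for most keys. Acceptance plus
rejection is the trace, here `2 Tr (PΔ)`, and rejection of `Pρ + ρP` is small by Cauchy–Schwarz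
because an honest ciphertext `ρ` is rarely rejected (`abs_rejectProb_anticommutator_le`). Averaging
over keys gives the linear bound `5δ + 2√ε` (`isEncrypting_linear`), which implies the square-root
bound. -/

lemma traceNorm_nonneg (A : Op X) : 0 ≤ traceNorm A :=
  (Complex.le_def.1
    (Matrix.nonneg_iff_posSemidef.1 (CFC.sqrt_nonneg (A.conjTranspose * A))).trace_nonneg).1

/-- A principal minor of size two of a positive semidefinite matrix is nonnegative. -/
lemma normSq_apply_le_of_posSemidef {Y : Type*} {B : Op Y} (hB : B.PosSemidef) (i j : Y) :
    Complex.normSq (B i j) ≤ (B i i).re * (B j j).re := by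
  have h := (hB.submatrix ![i, j]).det_nonneg
  rw [Matrix.det_fin_two] at h
  have hji : B j i = star (B i j) := (hB.isHermitian.apply j i).symm
  have hi := Complex.le_def.1 (hB.diag_nonneg (i := i))
  have hj := Complex.le_def.1 (hB.diag_nonneg (i := j))
  have h' := (Complex.le_def.1 h).1
  simp [hji] at h' hi hj
  rw [Complex.normSq_apply]
  nlinarith [hi.2, hj.2]

/-- Every entry of an operator is bounded by its trace norm. -/
lemma norm_apply_le_traceNorm (A : Op X) (i j : X) : ‖A i j‖ ≤ traceNorm A := by
  set B : Op X := CFC.sqrt (A.conjTranspose * A) with hBdef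
  have hB : B.PosSemidef := Matrix.nonneg_iff_posSemidef.1 (CFC.sqrt_nonneg _)
  have hsq : B * B = A.conjTranspose * A :=
    CFC.sqrt_mul_sqrt_self _ (Matrix.posSemidef_conjTranspose_mul_self A).nonneg
  have hd : ∀ k, 0 ≤ (B k k).re := fun k => (Complex.le_def.1 hB.diag_nonneg).1
  have htr : traceNorm A = ∑ k, (B k k).re := by
    simp [traceNorm, ← hBdef, Matrix.trace]
  have hA : ((A.conjTranspose * A) j j).re = ∑ k, Complex.normSq (A k j) := by
    simp [Matrix.mul_apply, Complex.normSq_apply]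
  have hBB : ((B * B) j j).re = ∑ k, Complex.normSq (B k j) := by
    nth_rewrite 1 [← hB.isHermitian.eq]
    simp [Matrix.mul_apply, Complex.normSq_apply]
  -- `A` and `B = |A|` have columns of equal norm, and the minors of `B` bound its column `j` by `Tr
  -- B · B j j ≤ (Tr B)²`.
  have h1 : Complex.normSq (A i j) ≤ ∑ k, Complex.normSq (A k j) :=
    Finset.single_le_sum (f := fun k => Complex.normSq (A k j))
      (fun k _ => Complex.normSq_nonneg _) (Finset.mem_univ i)
  have h2 : ∑ k, Complex.normSq (B k j) ≤ (∑ k, (B k k).re) * (B j j).re := by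
    rw [Finset.sum_mul]
    exact Finset.sum_le_sum fun k _ => normSq_apply_le_of_posSemidef hB k j
  have h3 : (B j j).re ≤ ∑ k, (B k k).re :=
    Finset.single_le_sum (f := fun k => (B k k).re) (fun k _ => hd k) (Finset.mem_univ j)
  refine le_of_sq_le_sq ?_ (traceNorm_nonneg A)
  rw [← Complex.normSq_eq_norm_sq, htr]
  have : ∑ k, Complex.normSq (A k j) = ∑ k, Complex.normSq (B k j) := by
    rw [← hA, ← hBB, hsq]
  nlinarith [hd j]

/-- For a traceless Hermitian operator, half of the trace norm is attained by testing against an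
orthogonal projection. -/
lemma exists_projection_trace_mul_eq {L : Op X} (hL : L.IsHermitian) (htr : L.trace = 0) :
    ∃ P : Op X, P.IsHermitian ∧ P * P = P ∧ (P * L).trace.re = 1 / 2 * traceNorm L := by
  have hc (f : ℝ → ℝ) : ContinuousOn f (spectrum ℝ L) :=
    Matrix.finite_real_spectrum.continuousOn f
  have hsa : IsSelfAdjoint L := hL
  let s : ℝ → ℝ := fun x => if 0 ≤ x then 1 else 0
  refine ⟨cfc s L, cfc_predicate s L, ?_, ?_⟩
  · rw [← cfc_mul s s L (hc _) (hc _)]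
    congr 1
    ext x
    by_cases hx : 0 ≤ x <;> simp [s, hx]
  -- Functional calculus of `|x| + x = 2 s(x) x`; the trace then removes the summand `L`.
  · have habs : CFC.abs L + L = (2 : ℝ) • (cfc s L * L) := by
      have hid : cfc s L * L = cfc (fun x => s x * x) L := by
        rw [cfc_mul s (fun x => x) L (hc _) (hc _), cfc_id' ℝ L]
      rw [CFC.abs_eq_cfc_norm L hsa, hid, ← cfc_smul _ _ _ (hc _)]
      nth_rewrite 2 [← cfc_id' ℝ L]
      rw [← cfc_add _ _ _ (hc _) (hc _)]
      congr 1
      ext x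
      by_cases hx : 0 ≤ x
      · simp [s, hx, abs_of_nonneg hx]; ring
      · simp [s, hx, abs_of_neg (not_le.1 hx)]
    have h := congrArg (fun M => (Matrix.trace M).re) habs
    simp only [Matrix.trace_add, htr, add_zero, Matrix.trace_smul, Complex.smul_re,
      smul_eq_mul] at h
    have hn : traceNorm L = (CFC.abs L).trace.re := rfl
    rw [hn, h]
    ring

end TraceNorm

/-! ### Positive functionals and channels -/

section Channel

variable {X Y : Type*} [Fintype X] [Fintype Y]

lemma posSemidef_basisState {Z : Type*} [Fintype Z] [DecidableEq Z] (x : Z) :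
    (basisState x).PosSemidef := by
  have h := Matrix.posSemidef_vecMulVec_self_star (Pi.single x (1 : ℂ) : Z → ℂ)
  convert h using 1
  ext i j
  simp only [basisState, Matrix.single_apply, Matrix.vecMulVec_apply, Pi.single_apply,
    Pi.star_apply]
  split_ifs <;> first | (simp; done) | grind

lemma trace_basisState {Z : Type*} [Fintype Z] [DecidableEq Z] (x : Z) :
    (basisState x).trace = 1 := by
  simp [basisState]

lemma IsChannel.posSemidef {Φ : Op X →ₗ[ℂ] Op Y} (hΦ : IsChannel Φ) {M : Op X}
    (hM : M.PosSemidef) : (Φ M).PosSemidef :=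
  (hΦ.completely_positive Unit (M.submatrix Prod.fst Prod.fst) (hM.submatrix _)).submatrix
    fun y => (y, ())

/-- Conjugation by an isometry is a channel. -/
lemma isChannel_conj [DecidableEq X] (V : Matrix Y X ℂ) (hV : V.conjTranspose * V = 1)
    (Φ : Op X →ₗ[ℂ] Op Y) (hΦ : ∀ M, Φ M = V * M * V.conjTranspose) : IsChannel Φ where
  completely_positive Z _ M hM := by
    classical
    have h : tensorId Φ Z M = (V ⊗ₖ (1 : Op Z)) * M * (V ⊗ₖ (1 : Op Z)).conjTranspose := by
      ext ⟨y, z⟩ ⟨y', z'⟩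
      simp [tensorId, hΦ, Matrix.mul_apply, Fintype.sum_prod_type, Matrix.one_apply,
        Matrix.kroneckerMap_apply, apply_ite (starRingEnd ℂ)]
    rw [h]
    exact hM.mul_mul_conjTranspose_same _
  trace_preserving L := by
    rw [hΦ, Matrix.trace_mul_comm, ← Matrix.mul_assoc, hV, Matrix.one_mul]

/-- The Cauchy–Schwarz inequality for the form `(A, B) ↦ g (A ρ B†)` of a positive functional. -/
lemma sq_re_anticommutator_le [DecidableEq X] (g : Op X →ₗ[ℂ] ℂ)
    (hg : ∀ M : Op X, M.PosSemidef → 0 ≤ (g M).re) {P ρ : Op X} (hP : P.IsHermitian)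
    (hρ : ρ.PosSemidef) :
    (g (P * ρ + ρ * P)).re ^ 2 ≤ 4 * (g ρ).re * (g (P * ρ * P)).re := by
  -- Positivity of `g` on `(P + t) ρ (P + t)†` for every real `t` forces a nonpositive discriminant.
  have h : ∀ t : ℝ, 0 ≤ (g ρ).re * (t * t) + (g (P * ρ + ρ * P)).re * t
      + (g (P * ρ * P)).re := by
    intro t
    have hpos := hg _ (hρ.mul_mul_conjTranspose_same (P + (t : ℂ) • (1 : Op X)))
    have hexp : (P + (t : ℂ) • (1 : Op X)) * ρ * (P + (t : ℂ) • (1 : Op X)).conjTranspose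
        = ((t * t : ℝ) : ℂ) • ρ + (t : ℂ) • (P * ρ + ρ * P) + P * ρ * P := by
      simp only [Matrix.conjTranspose_add, hP.eq, Matrix.conjTranspose_smul,
        Matrix.conjTranspose_one, Matrix.add_mul, Matrix.mul_add, Matrix.smul_mul,
        Matrix.mul_smul, Matrix.one_mul, Matrix.mul_one, smul_add, smul_smul]
      simp
      abel
    rw [hexp, map_add, map_add, map_smul, map_smul] at hpos
    simp only [Complex.add_re, smul_eq_mul, Complex.re_ofReal_mul] at hpos
    linarith
  have := discrim_le_zero h
  rw [discrim] at this
  linarith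

lemma conjTranspose_mul_self_add_of_projection [DecidableEq X] {P : Op X} (hP : P.IsHermitian)
    (hPP : P * P = P) :
    P.conjTranspose * P + (1 - P).conjTranspose * (1 - P) = 1 := by
  simp [hP.eq, hPP, Matrix.mul_sub, Matrix.sub_mul]

/-- Testing a positive operator against a projection gives at most its trace. -/
lemma trace_projection_mem_Icc [DecidableEq X] {P ρ : Op X} (hP : P.IsHermitian)
    (hPP : P * P = P) (hρ : ρ.PosSemidef) :
    0 ≤ (P * ρ).trace.re ∧ (P * ρ).trace.re ≤ ρ.trace.re := by
  have key : ∀ Q : Op X, Q.IsHermitian → Q * Q = Q → 0 ≤ (Q * ρ).trace.re := by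
    intro Q hQ hQQ
    have h := (Complex.le_def.1 (hρ.mul_mul_conjTranspose_same Q).trace_nonneg).1
    rwa [hQ.eq, Matrix.trace_mul_comm, ← Matrix.mul_assoc, hQQ] at h
  refine ⟨key P hP hPP, ?_⟩
  have h := key (1 - P) (Matrix.isHermitian_one.sub hP)
    (by simp [hPP, Matrix.mul_sub, Matrix.sub_mul])
  simp only [Matrix.sub_mul, Matrix.one_mul, Matrix.trace_sub, Complex.sub_re] at h
  linarith

end Channel

/-! ### The coherent measurement attack -/

section CoherentMeasurement

variable {X : Type*} [Fintype X] [DecidableEq X]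

/-- The isometry `|c⟩ ↦ P|c⟩ ⊗ |1⟩ + (1 - P)|c⟩ ⊗ |0⟩`. -/
def measureIsometry (P : Op X) : Matrix (X × Bool) X ℂ :=
  Matrix.of fun p x => (if p.2 then P else 1 - P) p.1 x

/-- The coherent implementation of the measurement `{P, 1 - P}`. -/
def measureAttack (P : Op X) : Op X →ₗ[ℂ] Op (X × Bool) where
  toFun M := measureIsometry P * M * (measureIsometry P).conjTranspose
  map_add' M N := by rw [Matrix.mul_add, Matrix.add_mul]
  map_smul' c M := by simp

lemma isChannel_measureAttack {P : Op X} (hP : P.IsHermitian) (hPP : P * P = P) :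
    IsChannel (measureAttack P) := by
  refine isChannel_conj (measureIsometry P) ?_ _ fun M => rfl
  rw [← conjTranspose_mul_self_add_of_projection hP hPP]
  ext i j
  simp only [measureIsometry, Matrix.mul_apply, Fintype.sum_prod_type, Fintype.sum_bool,
    Finset.sum_add_distrib, Matrix.add_apply, Matrix.conjTranspose_apply, Matrix.of_apply,
    if_true, Bool.false_eq_true, if_false]

lemma measureAttack_submatrix (P M : Op X) (b b' : Bool) :
    (measureAttack P M).submatrix (fun x => (x, b)) (fun x => (x, b'))
      = (if b then P else 1 - P) * M * (if b' then P else 1 - P).conjTranspose := by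
  ext i j
  simp only [measureAttack, measureIsometry, Matrix.mul_apply, Matrix.submatrix_apply,
    LinearMap.coe_mk, AddHom.coe_mk, Matrix.conjTranspose_apply, Matrix.of_apply]

end CoherentMeasurement

/-! ### Acceptance, rejection and the distinguishing advantage -/

namespace AQECM

variable {𝒦 ℳ 𝒞 : Type*} [Fintype 𝒦] [Fintype ℳ] [Fintype 𝒞]

lemma keyProb_nonneg (S : AQECM 𝒦 ℳ 𝒞) (k : 𝒦) : 0 ≤ S.keyProb k :=
  (Complex.le_def.1 (S.keyGen_channel.posSemidef Matrix.PosSemidef.one).diag_nonneg).1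

lemma sum_keyProb (S : AQECM 𝒦 ℳ 𝒞) : ∑ k, S.keyProb k = 1 := by
  have h := congrArg Complex.re (S.keyGen_channel.trace_preserving 1)
  simpa [Matrix.trace, keyProb] using h

variable [DecidableEq 𝒦]

/-- The linear functional giving the acceptance probability of the decoder with key `k`. -/
def acceptProb (S : AQECM 𝒦 ℳ 𝒞) (k : 𝒦) : Op 𝒞 →ₗ[ℂ] ℂ :=
  Matrix.traceLinearMap ℳ ℂ ℂ ∘ₗ S.decAccept k

/-- The linear functional giving the rejection probability of the decoder with key `k`. -/
def rejectProb (S : AQECM 𝒦 ℳ 𝒞) (k : 𝒦) : Op 𝒞 →ₗ[ℂ] ℂ :=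
  Matrix.traceLinearMap 𝒞 ℂ ℂ - S.acceptProb k

lemma decKey_posSemidef (S : AQECM 𝒦 ℳ 𝒞) (k : 𝒦) {ρ : Op 𝒞} (hρ : ρ.PosSemidef) :
    (S.decKey k ρ).PosSemidef :=
  S.dec_channel.posSemidef ((posSemidef_basisState k).kronecker hρ)

lemma decKey_trace (S : AQECM 𝒦 ℳ 𝒞) (k : 𝒦) (ρ : Op 𝒞) :
    (S.decKey k ρ).trace = ρ.trace := by
  refine (S.dec_channel.trace_preserving _).trans ?_
  refine (Matrix.trace_kronecker _ _).trans ?_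
  rw [trace_basisState, one_mul]

lemma encKey_posSemidef (S : AQECM 𝒦 ℳ 𝒞) (k : 𝒦) {ρ : Op ℳ} (hρ : ρ.PosSemidef) :
    (S.encKey k ρ).PosSemidef :=
  S.enc_channel.posSemidef ((posSemidef_basisState k).kronecker hρ)

lemma encKey_trace (S : AQECM 𝒦 ℳ 𝒞) (k : 𝒦) (ρ : Op ℳ) :
    (S.encKey k ρ).trace = ρ.trace := by
  refine (S.enc_channel.trace_preserving _).trans ?_
  refine (Matrix.trace_kronecker _ _).trans ?_
  rw [trace_basisState, one_mul]

/-- Since decoding preserves the trace, rejection is the trace of the flag-`false` block. -/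
lemma rejectProb_nonneg (S : AQECM 𝒦 ℳ 𝒞) (k : 𝒦) (ρ : Op 𝒞) (hρ : ρ.PosSemidef) :
    0 ≤ (S.rejectProb k ρ).re := by
  have h : S.rejectProb k ρ = ∑ m, S.decKey k ρ (m, false) (m, false) := by
    rw [rejectProb, LinearMap.sub_apply, Matrix.traceLinearMap_apply, ← S.decKey_trace k]
    simp [acceptProb, decAccept, Matrix.trace, Fintype.sum_prod_type, Finset.sum_add_distrib]
  rw [h, Complex.re_sum]
  exact Finset.sum_nonneg fun m _ => (Complex.le_def.1 (S.decKey_posSemidef k hρ).diag_nonneg).1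

lemma rejectProb_le (S : AQECM 𝒦 ℳ 𝒞) (k : 𝒦) {ρ : Op 𝒞} (hρ : ρ.PosSemidef) (m : ℳ) :
    (S.rejectProb k ρ).re ≤ ρ.trace.re - (S.decAccept k ρ m m).re := by
  have hd : ∀ m, 0 ≤ (S.decAccept k ρ m m).re := fun m =>
    (Complex.le_def.1 ((S.decKey_posSemidef k hρ).submatrix _).diag_nonneg).1
  have h := Finset.single_le_sum (f := fun m => (S.decAccept k ρ m m).re)
    (fun m _ => hd m) (Finset.mem_univ m)
  simp only [rejectProb, acceptProb, LinearMap.sub_apply, Matrix.traceLinearMap_apply,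
    LinearMap.comp_apply, Complex.sub_re]
  have htr : (S.decAccept k ρ).trace.re = ∑ m, (S.decAccept k ρ m m).re := by
    simp [Matrix.trace]
  linarith

/-- Rejection is insensitive to a projection acting on one side of a mostly accepted state. -/
lemma abs_rejectProb_anticommutator_le [DecidableEq 𝒞] (S : AQECM 𝒦 ℳ 𝒞) (k : 𝒦)
    {P ρ : Op 𝒞} (hP : P.IsHermitian) (hPP : P * P = P) (hρ : ρ.PosSemidef)
    (htr : ρ.trace = 1) :
    |(S.rejectProb k (P * ρ + ρ * P)).re| ≤ 2 * √(S.rejectProb k ρ).re := by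
  have hcs := sq_re_anticommutator_le (S.rejectProb k) (S.rejectProb_nonneg k) hP hρ
  have hr := S.rejectProb_nonneg k ρ hρ
  have hPρ : (P * ρ * P).PosSemidef := by
    simpa [hP.eq] using hρ.mul_mul_conjTranspose_same P
  have hle : (S.rejectProb k (P * ρ * P)).re ≤ 1 := by
    have h1 : (S.rejectProb k (P * ρ * P)).re ≤ (P * ρ * P).trace.re := by
      have hacc : 0 ≤ (S.acceptProb k (P * ρ * P)).re :=
        (Complex.le_def.1 ((S.decKey_posSemidef k hPρ).submatrix _).trace_nonneg).1
      simp only [rejectProb, LinearMap.sub_apply, Matrix.traceLinearMap_apply, Complex.sub_re]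
      linarith
    have h2 : (P * ρ * P).trace = (P * ρ).trace := by
      rw [Matrix.trace_mul_comm, ← Matrix.mul_assoc, hPP]
    have h3 := (trace_projection_mem_Icc hP hPP hρ).2
    rw [htr, Complex.one_re] at h3
    rw [h2] at h1
    linarith
  refine abs_le_of_sq_le_sq ?_ (by positivity)
  rw [mul_pow, Real.sq_sqrt hr]
  nlinarith

/-- Decoding and tracing out the message act separately on each block indexed by the adversary's
qubit. -/
lemma attackOutput_measureAttack [DecidableEq 𝒞] (S : AQECM 𝒦 ℳ 𝒞) (k : 𝒦) {P : Op 𝒞}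
    (L : Op ℳ) (b b' : Bool) :
    S.attackOutput (measureAttack P) k L b b'
      = S.acceptProb k ((if b then P else 1 - P) * S.encKey k L
          * (if b' then P else 1 - P).conjTranspose) := by
  rw [← measureAttack_submatrix]
  rfl

/-- The entries of the adversary's output under a coherent measurement determine the acceptance
functional on the anticommutator with the measured projection. -/
lemma acceptProb_anticommutator [DecidableEq 𝒞] (S : AQECM 𝒦 ℳ 𝒞) (k : 𝒦) {P : Op 𝒞}
    (hP : P.IsHermitian) (L : Op ℳ) :
    S.acceptProb k (P * S.encKey k L + S.encKey k L * P)
      = S.attackOutput (measureAttack P) k L true false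
        + S.attackOutput (measureAttack P) k L false true
        + 2 * S.attackOutput (measureAttack P) k L true true := by
  simp only [attackOutput_measureAttack, two_mul, ← map_add]
  congr 1
  simp [hP.eq, Matrix.mul_sub, Matrix.sub_mul]
  abel

variable [DecidableEq ℳ]

/-- For every key, the advantage of a projective test is controlled by the trace norm of the
output of the corresponding coherent measurement attack and the rejection probabilities. -/
lemma trace_projection_mul_encKey_le [DecidableEq 𝒞] (S : AQECM 𝒦 ℳ 𝒞) (k : 𝒦) {P : Op 𝒞}
    (hP : P.IsHermitian) (hPP : P * P = P) (m₀ m₁ : ℳ) :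
    (P * S.encKey k (basisState m₀ - basisState m₁)).trace.re
      ≤ 2 * traceNorm (S.attackOutput (measureAttack P) k (basisState m₀ - basisState m₁))
        + √(S.rejectProb k (S.encKey k (basisState m₀))).re
        + √(S.rejectProb k (S.encKey k (basisState m₁))).re := by
  set A := S.attackOutput (measureAttack P) k (basisState m₀ - basisState m₁) with hA
  set Δ := S.encKey k (basisState m₀ - basisState m₁) with hΔ
  have hacc := congrArg Complex.re (S.acceptProb_anticommutator k hP (basisState m₀ - basisState m₁))
  rw [← hA, ← hΔ] at hacc
  simp only [Complex.add_re, Complex.mul_re, Complex.re_ofNat, Complex.im_ofNat, zero_mul,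
    sub_zero] at hacc
  have entry : ∀ b b', (A b b').re ≤ traceNorm A := fun b b' =>
    (Complex.re_le_norm _).trans (norm_apply_le_traceNorm A b b')
  have hrej : ∀ m, |(S.rejectProb k (P * S.encKey k (basisState m)
      + S.encKey k (basisState m) * P)).re| ≤ _ := fun m =>
    S.abs_rejectProb_anticommutator_le k hP hPP (S.encKey_posSemidef k (posSemidef_basisState m))
      (by rw [encKey_trace, trace_basisState])
  have hsplit : S.rejectProb k (P * Δ + Δ * P)
      = S.rejectProb k (P * S.encKey k (basisState m₀) + S.encKey k (basisState m₀) * P)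
        - S.rejectProb k (P * S.encKey k (basisState m₁) + S.encKey k (basisState m₁) * P) := by
    rw [← map_sub]
    congr 1
    simp only [hΔ, map_sub, Matrix.mul_sub, Matrix.sub_mul]
    abel
  -- The trace splits into acceptance, at most four times the trace norm of `A` by its entries, and
  -- rejection, bounded by `hrej`.
  have htr : S.acceptProb k (P * Δ + Δ * P) + S.rejectProb k (P * Δ + Δ * P)
      = 2 * (P * Δ).trace := by
    simp only [rejectProb, LinearMap.sub_apply, Matrix.traceLinearMap_apply, Matrix.trace_add,
      Matrix.trace_mul_comm Δ P]
    ring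
  have htr' := congrArg Complex.re htr
  rw [hsplit] at htr'
  simp only [Complex.add_re, Complex.sub_re, Complex.mul_re, Complex.re_ofNat, Complex.im_ofNat,
    zero_mul, sub_zero] at htr'
  have h0 := abs_le.1 (hrej m₀)
  have h1 := abs_le.1 (hrej m₁)
  have := entry true false
  have := entry false true
  have := entry true true
  linarith [h0.2, h1.1]

/-- The trivial bound, needed for the keys on which the tamper-evidence estimate fails. -/
lemma trace_projection_mul_encKey_le_one [DecidableEq 𝒞] (S : AQECM 𝒦 ℳ 𝒞) (k : 𝒦)
    {P : Op 𝒞} (hP : P.IsHermitian) (hPP : P * P = P) (m₀ m₁ : ℳ) :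
    (P * S.encKey k (basisState m₀ - basisState m₁)).trace.re ≤ 1 := by
  have h0 := (trace_projection_mem_Icc hP hPP
    (S.encKey_posSemidef k (posSemidef_basisState m₀))).2
  have h1 := (trace_projection_mem_Icc hP hPP
    (S.encKey_posSemidef k (posSemidef_basisState m₁))).1
  rw [encKey_trace, trace_basisState, Complex.one_re] at h0
  rw [map_sub, Matrix.mul_sub, Matrix.trace_sub, Complex.sub_re]
  linarith

/-- The average root of the rejection probability of an honest ciphertext of a correct scheme. -/
lemma sum_keyProb_mul_sqrt_rejectProb_le (S : AQECM 𝒦 ℳ 𝒞) {ε : ℝ} (h : S.IsCorrect ε) (m : ℳ) :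
    ∑ k, S.keyProb k * √(S.rejectProb k (S.encKey k (basisState m))).re ≤ √ε := by
  set r : 𝒦 → ℝ := fun k => (S.rejectProb k (S.encKey k (basisState m))).re
  have hρ := fun k => S.encKey_posSemidef k (posSemidef_basisState m)
  have hr : ∀ k, 0 ≤ r k := fun k => S.rejectProb_nonneg k _ (hρ k)
  have hp := S.keyProb_nonneg
  refine Real.le_sqrt_of_sq_le ?_
  -- Jensen's inequality for the square root, as Cauchy–Schwarz with the key probabilities as
  -- weights.
  have hcs := Finset.sum_sq_le_sum_mul_sum_of_sq_le_mul Finset.univ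
    (r := fun k => S.keyProb k * √(r k)) (f := S.keyProb) (g := fun k => S.keyProb k * r k)
    (fun k _ => hp k) (fun k _ => mul_nonneg (hp k) (hr k))
    (fun k _ => by rw [mul_pow, Real.sq_sqrt (hr k)]; exact le_of_eq (by ring))
  rw [S.sum_keyProb, one_mul] at hcs
  refine hcs.trans ?_
  have hle : ∑ k, S.keyProb k * r k ≤ ∑ k, (S.keyProb k
      - S.keyProb k * (S.decAccept k (S.encKey k (basisState m)) m m).re) := by
    refine Finset.sum_le_sum fun k _ => ?_
    have h1 := S.rejectProb_le k (hρ k) m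
    rw [encKey_trace, trace_basisState, Complex.one_re] at h1
    have := mul_le_mul_of_nonneg_left h1 (hp k)
    simp only [r]
    linarith
  rw [Finset.sum_sub_distrib, S.sum_keyProb] at hle
  have := h m
  linarith

/-- Correctness and tamper evidence bound the distinguishing advantage linearly in `δ` and `√ε`. -/
lemma isEncrypting_linear [DecidableEq 𝒞] (S : AQECM 𝒦 ℳ 𝒞) {ε δ : ℝ} (hc : S.IsCorrect ε)
    (ht : S.IsTamperEvident δ) (m₀ m₁ : ℳ) :
    0 ≤ δ ∧
    1 / 2 * traceNorm (∑ k, (S.keyProb k : ℂ) • S.encKey k (basisState m₀ - basisState m₁))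
      ≤ min 1 (5 * δ + 2 * √ε) := by
  classical
  set L := ∑ k, (S.keyProb k : ℂ) • S.encKey k (basisState m₀ - basisState m₁) with hLdef
  have hp := S.keyProb_nonneg
  have hherm : L.IsHermitian := by
    rw [hLdef, Matrix.IsHermitian, Matrix.conjTranspose_sum]
    refine Finset.sum_congr rfl fun k _ => ?_
    rw [Matrix.conjTranspose_smul, map_sub, Matrix.conjTranspose_sub,
      (S.encKey_posSemidef k (posSemidef_basisState m₀)).isHermitian.eq,
      (S.encKey_posSemidef k (posSemidef_basisState m₁)).isHermitian.eq]
    simp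
  have htr : L.trace = 0 := by
    rw [hLdef, Matrix.trace_sum]
    refine Finset.sum_eq_zero fun k _ => ?_
    simp [Matrix.trace_smul, encKey_trace, Matrix.trace_sub, trace_basisState]
  obtain ⟨P, hP, hPP, hPL⟩ := exists_projection_trace_mul_eq hherm htr
  have hsum : (P * L).trace.re = ∑ k, S.keyProb k
      * (P * S.encKey k (basisState m₀ - basisState m₁)).trace.re := by
    rw [hLdef, Matrix.mul_sum, Matrix.trace_sum, Complex.re_sum]
    refine Finset.sum_congr rfl fun k _ => ?_
    rw [Matrix.mul_smul, Matrix.trace_smul, smul_eq_mul, Complex.re_ofReal_mul]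
  set N : 𝒦 → ℝ := fun k =>
    traceNorm (S.attackOutput (measureAttack P) k (basisState m₀ - basisState m₁)) with hN
  have hte : 1 - δ ≤ ∑ k, if 1 / 2 * N k ≤ δ then S.keyProb k else 0 := by
    simpa [probKey, Set.indicator_apply] using
      ht m₀ m₁ Bool (measureAttack P) (isChannel_measureAttack hP hPP)
  have hδ : 0 ≤ δ := by
    have : (∑ k, if 1 / 2 * N k ≤ δ then S.keyProb k else 0) ≤ ∑ k, S.keyProb k := by
      refine Finset.sum_le_sum fun k _ => ?_
      split_ifs
      exacts [le_rfl, hp k]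
    rw [S.sum_keyProb] at this
    linarith
  refine ⟨hδ, ?_⟩
  rw [← hPL, hsum, le_min_iff]
  constructor
  · calc _ ≤ ∑ k, S.keyProb k * 1 := Finset.sum_le_sum fun k _ =>
          mul_le_mul_of_nonneg_left (S.trace_projection_mul_encKey_le_one k hP hPP m₀ m₁) (hp k)
      _ = 1 := by simp [S.sum_keyProb]
  · set r : ℳ → 𝒦 → ℝ := fun m k => √(S.rejectProb k (S.encKey k (basisState m))).re with hr
    -- On good keys `N k ≤ 2δ` yields `4δ`. The last summand is the weight of a bad key; these
    -- weights total at most `δ`, giving `5δ`.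
    have hle : ∀ k, S.keyProb k * (P * S.encKey k (basisState m₀ - basisState m₁)).trace.re
        ≤ S.keyProb k * (4 * δ) + S.keyProb k * r m₀ k + S.keyProb k * r m₁ k
          + (S.keyProb k - if 1 / 2 * N k ≤ δ then S.keyProb k else 0) := by
      intro k
      have h0 : 0 ≤ r m₀ k := Real.sqrt_nonneg _
      have h1 : 0 ≤ r m₁ k := Real.sqrt_nonneg _
      split_ifs with hk
      · have h := S.trace_projection_mul_encKey_le k hP hPP m₀ m₁
        have h' : (P * S.encKey k (basisState m₀ - basisState m₁)).trace.re
            ≤ 4 * δ + r m₀ k + r m₁ k := by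
          refine h.trans ?_
          simp only [hr, hN] at hk ⊢
          linarith
        have := mul_le_mul_of_nonneg_left h' (hp k)
        linarith
      · have h := mul_le_mul_of_nonneg_left
          (S.trace_projection_mul_encKey_le_one k hP hPP m₀ m₁) (hp k)
        have := mul_nonneg (hp k) h0
        have := mul_nonneg (hp k) h1
        have := mul_nonneg (hp k) hδ
        linarith
    refine (Finset.sum_le_sum fun k _ => hle k).trans ?_
    rw [Finset.sum_add_distrib, Finset.sum_add_distrib, Finset.sum_add_distrib,
      Finset.sum_sub_distrib, ← Finset.sum_mul, S.sum_keyProb]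
    have h0 := S.sum_keyProb_mul_sqrt_rejectProb_le hc m₀
    have h1 := S.sum_keyProb_mul_sqrt_rejectProb_le hc m₁
    simp only [hr]
    linarith

end AQECM

end TamperEvidence

end

theorem mainTheorem1 {𝒦 ℳ 𝒞 : Type*} [Fintype 𝒦] [Fintype ℳ] [Fintype 𝒞]
    [DecidableEq 𝒦] [DecidableEq ℳ] [DecidableEq 𝒞]
    (S : TamperEvidence.AQECM 𝒦 ℳ 𝒞) (ε δ : ℝ)
    (hcorrect : S.IsCorrect ε) (htamper : S.IsTamperEvident δ) :
    S.IsEncrypting (Real.sqrt (19 * (δ + Real.sqrt (2 * ε)))) := by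
  intro m₀ m₁
  obtain ⟨hδ, h⟩ := S.isEncrypting_linear hcorrect htamper m₀ m₁
  obtain ⟨h1, h2⟩ := le_min_iff.1 h
  have h0 := TamperEvidence.traceNorm_nonneg
    (∑ k, (S.keyProb k : ℂ) • S.encKey k
      (TamperEvidence.basisState m₀ - TamperEvidence.basisState m₁))
  -- No sign of `ε` is assumed; for `ε ≤ 0` the left root is `0`.
  have hε : √ε ≤ √(2 * ε) := by
    rcases le_total 0 ε with h | h
    · exact Real.sqrt_le_sqrt (by linarith)
    · rw [Real.sqrt_eq_zero_of_nonpos h]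
      exact Real.sqrt_nonneg _
  have hs := Real.sqrt_nonneg (2 * ε)
  refine Real.le_sqrt_of_sq_le ?_
  -- The advantage `T` lies in `[0, 1]`, so `T² ≤ T ≤ 5δ + 2√ε`; the constant 19 leaves slack.
  nlinarith
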